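/- For a finite simple graph $G$ on $n$ vertices, let $\lambda_1,\dots,\lambda_n$ be the eigenvalues of its adjacency matrix, counted with multiplicity, and for real $p>0$ let its $p$-Schatten energy be $$\mathcal{E}_p(G)=\sum_{i=1}^{n}|\lambda_i|^p .$$ Let $n\ge 1$, let $S_n$ be the star on $n$ vertices (one vertex joined to all the $n-1$ others, with no further edges) and let $P_n$ be the path on $n$ vertices. Then for every tree $T_n$ on $n$ vertices and every real $p$ with $0<p<2$, $$\mathcal{E}_p(S_n)\le \mathcal{E}_p(T_n)\le \mathcal{E}_p(P_n).$$ -/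

import Mathlib

namespace SchattenEnergy

open Classical in
/-- The real adjacency matrix of a graph is Hermitian (being real symmetric). -/
theorem adjMatrix_isHermitian {V : Type*} (G : SimpleGraph V) :
    (G.adjMatrix ℝ).IsHermitian := by
  ext i j
  simp [SimpleGraph.adjMatrix_apply, G.adj_comm]

open Classical in
/-- The `p`-Schatten energy of a finite graph: the sum of `|λ| ^ p` over the eigenvalues `λ` of its
real adjacency matrix, counted with multiplicity. -/
noncomputable def energy {V : Type*} [Fintype V] (p : ℝ) (G : SimpleGraph V) : ℝ :=
  ∑ i, |(adjMatrix_isHermitian G).eigenvalues i| ^ p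

end SchattenEnergy

/-!
Writing `|x| ^ p` as a multiple of `∫₀^∞ t ^ (-p - 1) log (1 + (t x) ^ 2) dt` turns the `p`-Schatten
energy of a graph `G` with adjacency matrix `A` into an integral, with positive weight, of
`log |f (G)| ^ 2` where `f (G) = det (1 + i t A)`, so it suffices to compare `|f (G)|` for each `t`.
If `v` is a leaf with neighbour `u`, then `f (G) = f (G - v) + t ^ 2 f (G - v - u)`. For a forest
all terms are positive, and induction on the edges squeezes `f (G)` between `1 + m t ^ 2`, where `m`
is the number of edges, and the solution of the same recursion for paths. The lower bound is the
value at the star with `m` edges.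
-/

namespace SchattenEnergy

section Matrix

open Matrix

variable {ι R : Type*} [Fintype ι] [DecidableEq ι] [CommRing R]

theorem adjugate_apply_eq_det_updateCol (M : Matrix ι ι R) (i j : ι) :
    M.adjugate i j = (M.updateCol i (Pi.single j 1)).det := by
  rw [← transpose_apply M.adjugate, adjugate_transpose, adjugate_apply, updateRow_transpose,
    det_transpose]

theorem adjugate_diag_eq_det_updateCol_updateRow (M : Matrix ι ι R) (i : ι) :
    M.adjugate i i = ((M.updateCol i (Pi.single i 1)).updateRow i (Pi.single i 1)).det := by
  rw [← adjugate_apply, adjugate_apply_eq_det_updateCol, adjugate_apply_eq_det_updateCol,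
    updateCol_idem]

theorem det_add_smul_single (M : Matrix ι ι R) (i j : ι) (c : R) :
    (M + c • single i j 1).det = M.det + c * M.adjugate j i := by
  have hrow : M + c • single i j 1 = M.updateRow i (M i + c • Pi.single j 1) := by
    ext k l
    obtain rfl | hk := eq_or_ne k i
    · simp [single_apply, Pi.single_apply, eq_comm]
    · simp [hk, hk.symm]
  rw [hrow, det_updateRow_add, updateRow_eq_self, det_updateRow_smul, adjugate_apply]

theorem det_one_add_smul_of_charpoly_eq_prod {K : Type*} [Field K] {M : Matrix ι ι K}
    {μ : ι → K} (h : M.charpoly = ∏ i, (Polynomial.X - Polynomial.C (μ i))) (a : K) :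
    (1 + a • M).det = ∏ i, (1 + a * μ i) := by
  obtain rfl | ha := eq_or_ne a 0
  · simp
  have hM : 1 + a • M = (-a) • (scalar ι (-a⁻¹) - M) := by
    rw [smul_sub, scalar_apply, ← smul_one_eq_diagonal, smul_smul, neg_mul_neg,
      mul_inv_cancel₀ ha, one_smul, neg_smul, sub_neg_eq_add]
  rw [hM, det_smul, ← eval_charpoly, h, Polynomial.eval_prod, Fintype.card, ← Finset.prod_const,
    ← Finset.prod_mul_distrib]
  refine Finset.prod_congr rfl fun i _ => ?_
  rw [Polynomial.eval_sub, Polynomial.eval_X, Polynomial.eval_C]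
  field_simp
  ring

end Matrix

section Determinant

open Matrix

theorem adjMatrix_eq_deleteIncidenceSet_add_of_leaf {V R : Type*} [DecidableEq V] [CommRing R]
    {G : SimpleGraph V} [DecidableRel G.Adj] {u v : V} (h : G.neighborSet v = {u}) :
    G.adjMatrix R = (G.deleteIncidenceSet v).adjMatrix R + single u v 1 + single v u 1 := by
  have hv : ∀ w, G.Adj v w ↔ w = u := Set.ext_iff.1 h
  have hv' : ∀ w, G.Adj w v ↔ w = u := fun w => by rw [G.adj_comm, hv]
  have huv : u ≠ v := ((hv u).2 rfl).ne'
  ext i j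
  by_cases hi : i = v <;> by_cases hj : j = v <;>
    simp [hi, hj, hv, hv', huv, SimpleGraph.adjMatrix_apply, SimpleGraph.deleteIncidenceSet_adj,
      single_apply, eq_comm (a := v), eq_comm (b := u)]

variable {V W R : Type*} [Fintype V] [Fintype W] [CommRing R]

open Classical in
/-- The determinant `det (1 + a A)`, where `A` is the adjacency matrix of `G`: the reversed
characteristic polynomial of `G` evaluated at `-a`. Unlike the characteristic polynomial, it
ignores isolated vertices. -/
noncomputable def shiftDet (a : R) (G : SimpleGraph V) : R :=
  (1 + a • G.adjMatrix R).det

theorem shiftDet_eq_det [DecidableEq V] (a : R) (G : SimpleGraph V) [DecidableRel G.Adj] :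
    shiftDet a G = (1 + a • G.adjMatrix R).det := by
  unfold shiftDet
  congr!

@[simp]
theorem shiftDet_bot (a : R) : shiftDet a (⊥ : SimpleGraph V) = 1 := by
  classical
  simp [shiftDet_eq_det]

@[simp]
theorem shiftDet_of_subsingleton [Subsingleton V] (a : R) (G : SimpleGraph V) :
    shiftDet a G = 1 := by
  rw [Subsingleton.elim G ⊥, shiftDet_bot]

theorem shiftDet_eq_of_support_subset_range (a : R) {G : SimpleGraph V} {H : SimpleGraph W}
    (f : G ↪g H) (hf : H.support ⊆ Set.range f) : shiftDet a H = shiftDet a G := by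
  classical
  let e : V ≃ {w // w ∈ Set.range f} := Equiv.ofInjective f f.injective
  rw [shiftDet_eq_det, shiftDet_eq_det, twoBlockTriangular_det _ (· ∈ Set.range f)]
  rotate_left
  · intro i hi j hj
    have hij : ¬ H.Adj i j := fun h => hi (hf ⟨j, h⟩)
    simp [one_apply, hij, (ne_of_mem_of_not_mem hj hi).symm]
  · have hrange : toSquareBlockProp (1 + a • H.adjMatrix R) (· ∈ Set.range f) =
        (1 + a • G.adjMatrix R).submatrix e.symm e.symm := by
      ext x y
      obtain ⟨x, rfl⟩ := e.surjective x
      obtain ⟨y, rfl⟩ := e.surjective y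
      simp [toSquareBlockProp_def, one_apply, e]
    have hcompl : toSquareBlockProp (1 + a • H.adjMatrix R) (· ∉ Set.range f) = 1 := by
      ext x y
      have hxy : ¬ H.Adj x y := fun h => x.2 (hf ⟨y, h⟩)
      simp [toSquareBlockProp_def, one_apply, hxy, Subtype.ext_iff]
    rw [hrange, hcompl, det_one, mul_one]
    convert det_submatrix_equiv_self e.symm _

theorem shiftDet_deleteIncidenceSet [DecidableEq V] (a : R) (G : SimpleGraph V)
    [DecidableRel G.Adj] (v : V) :
    shiftDet a (G.deleteIncidenceSet v) = (1 + a • G.adjMatrix R).adjugate v v := by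
  rw [adjugate_diag_eq_det_updateCol_updateRow, shiftDet_eq_det]
  congr 1
  ext i j
  by_cases hi : i = v <;> by_cases hj : j = v <;>
    simp [hi, hj, one_apply, updateRow_apply, eq_comm (a := v),
      SimpleGraph.adjMatrix_apply, SimpleGraph.deleteIncidenceSet_adj]

theorem shiftDet_eq_sub_of_leaf (a : R) {G : SimpleGraph V} {u v : V}
    (h : G.neighborSet v = {u}) :
    shiftDet a G = shiftDet a (G.deleteIncidenceSet v) -
      a ^ 2 * shiftDet a ((G.deleteIncidenceSet v).deleteIncidenceSet u) := by
  classical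
  have huv : u ≠ v := (show G.Adj v u from h.ge rfl).ne'
  set C : Matrix V V R := 1 + a • (G.deleteIncidenceSet v).adjMatrix R with hC
  have hB : 1 + a • G.adjMatrix R = C + a • single u v 1 + a • single v u 1 := by
    rw [adjMatrix_eq_deleteIncidenceSet_add_of_leaf h, hC, smul_add, smul_add, ← add_assoc,
      ← add_assoc]
  have hC_row : single u v 1 * C = single u v 1 := by
    ext i j
    by_cases hi : i = u <;>
      simp [hi, hC, one_apply, single_apply, eq_comm (a := u), SimpleGraph.adjMatrix_apply,
        SimpleGraph.deleteIncidenceSet_adj]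
  have hC_col : C * single v u 1 = single v u 1 := by
    ext i j
    by_cases hj : j = u <;>
      simp [hj, hC, one_apply, single_apply, eq_comm (a := u), eq_comm (a := v),
        SimpleGraph.adjMatrix_apply, SimpleGraph.deleteIncidenceSet_adj]
  -- Clearing the two off-diagonal entries at the leaf leaves `-a ^ 2` at the diagonal entry of `u`.
  have hcongr : transvection u v (-a) * (1 + a • G.adjMatrix R) * transvection v u (-a) =
      C + (-a ^ 2) • single u u 1 := by
    have hsingle : ∀ i j : V, single i j (-a) = (-a) • single i j (1 : R) := fun i j => by
      rw [smul_single, smul_eq_mul, mul_one]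
    rw [hB, transvection, transvection, hsingle, hsingle]
    simp only [mul_add, add_mul, one_mul, mul_one, smul_mul_assoc, mul_smul_comm, hC_row, hC_col,
      single_mul_single_same, single_mul_single_of_ne, huv, huv.symm, ne_eq,
      not_false_eq_true, zero_mul]
    module
  have hdet := congrArg Matrix.det hcongr
  rw [det_mul, det_mul, det_transvection_of_ne _ _ huv, det_transvection_of_ne _ _ huv.symm,
    one_mul, mul_one, det_add_smul_single] at hdet
  rw [shiftDet_eq_det, hdet, shiftDet_deleteIncidenceSet a (G.deleteIncidenceSet v),
    shiftDet_eq_det, ← hC]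
  ring

theorem shiftDet_starGraph (a : R) (c : V) :
    shiftDet a (SimpleGraph.starGraph c) = 1 - (Fintype.card V - 1) * a ^ 2 := by
  classical
  let w : V → R := 1 - Pi.single c 1
  have hA : (SimpleGraph.starGraph c).adjMatrix R =
      (of ![Pi.single c 1, w])ᵀ * of ![w, Pi.single c 1] := by
    ext i j
    by_cases hi : i = c <;> by_cases hj : j = c <;>
      simp [hi, hj, eq_comm (a := c), mul_apply, w, SimpleGraph.adjMatrix_apply]
  have hww : w ⬝ᵥ w = Fintype.card V - 1 := by
    simp [w, sub_dotProduct, dotProduct_sub]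
  have hwc : w c = 0 := by simp [w]
  have hB : 1 + a • of ![w, Pi.single c 1] * (of ![Pi.single c 1, w])ᵀ =
      !![1, a * (Fintype.card V - 1); a, 1] := by
    ext i j
    fin_cases i <;> fin_cases j <;> simp [vecMul_transpose, hww, hwc]
  rw [shiftDet_eq_det, hA, ← Matrix.mul_smul, det_one_add_mul_comm, hB, det_fin_two_of]
  ring

theorem shiftDet_eq_shiftDet_pathGraph (a : R) {k n : ℕ} (hk : k ≤ n) {G : SimpleGraph (Fin n)}
    (hG : ∀ x y, G.Adj x y ↔ (SimpleGraph.pathGraph n).Adj x y ∧ x.val < k ∧ y.val < k) :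
    shiftDet a G = shiftDet a (SimpleGraph.pathGraph k) := by
  let f : SimpleGraph.pathGraph k ↪g G :=
    { Fin.castLEEmb hk with
      map_rel_iff' := fun {x y} => by simp [hG, SimpleGraph.pathGraph_adj] }
  refine shiftDet_eq_of_support_subset_range a f ?_
  rintro x ⟨y, hxy⟩
  exact ⟨⟨x, ((hG x y).1 hxy).2.1⟩, rfl⟩

theorem shiftDet_pathGraph_add_two (a : R) (n : ℕ) :
    shiftDet a (SimpleGraph.pathGraph (n + 2)) =
      shiftDet a (SimpleGraph.pathGraph (n + 1)) -
        a ^ 2 * shiftDet a (SimpleGraph.pathGraph n) := by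
  have hleaf : (SimpleGraph.pathGraph (n + 2)).neighborSet (Fin.last (n + 1)) =
      {(Fin.last n).castSucc} := by
    ext w
    simp only [SimpleGraph.mem_neighborSet, SimpleGraph.pathGraph_adj, Set.mem_singleton_iff,
      Fin.ext_iff, Fin.val_last, Fin.val_castSucc]
    omega
  rw [shiftDet_eq_sub_of_leaf a hleaf, shiftDet_eq_shiftDet_pathGraph a (n + 1).le_succ,
    shiftDet_eq_shiftDet_pathGraph a (n.le_add_right 2)]
  all_goals
    intro x y
    simp only [SimpleGraph.deleteIncidenceSet_adj, SimpleGraph.pathGraph_adj, ne_eq, Fin.ext_iff,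
      Fin.val_last, Fin.val_castSucc]
    omega

end Determinant

section Forest

variable {V : Type*}

theorem exists_neighborSet_eq_singleton_of_isAcyclic [Finite V] {G : SimpleGraph V}
    (hG : G.IsAcyclic) (hne : G ≠ ⊥) : ∃ v u, G.neighborSet v = {u} := by
  classical
  have := Fintype.ofFinite V
  obtain ⟨x, y, hxy⟩ := SimpleGraph.ne_bot_iff_exists_adj.1 hne
  set c := G.connectedComponentMk x
  have hy : y ∈ c := SimpleGraph.ConnectedComponent.sound hxy.symm.reachable
  have : Nontrivial c := ⟨⟨x, rfl⟩, ⟨y, hy⟩, fun h => hxy.ne (congrArg Subtype.val h)⟩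
  obtain ⟨v, hv⟩ := (hG.isTree_connectedComponent c).exists_vert_degree_one_of_nontrivial
  obtain ⟨u, hvu, hu⟩ := SimpleGraph.degree_eq_one_iff_existsUnique_adj.1 hv
  refine ⟨v, u, Set.eq_singleton_iff_unique_mem.2 ⟨hvu, fun w hvw => ?_⟩⟩
  have hw : w ∈ c := c.mem_supp_of_adj_mem_supp v.2 hvw
  exact congrArg Subtype.val (hu ⟨w, hw⟩ hvw)

theorem isAcyclic_deleteIncidenceSet {G : SimpleGraph V} (hG : G.IsAcyclic) (v : V) :
    (G.deleteIncidenceSet v).IsAcyclic :=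
  hG.anti (G.deleteIncidenceSet_le v)

@[elab_as_elim]
theorem isAcyclic_induction [Finite V] {motive : (G : SimpleGraph V) → G.IsAcyclic → Prop}
    (bot : motive ⊥ SimpleGraph.isAcyclic_bot)
    (leaf : ∀ (G : SimpleGraph V) (hG : G.IsAcyclic) (v u : V), G.neighborSet v = {u} →
      motive (G.deleteIncidenceSet v) (isAcyclic_deleteIncidenceSet hG v) →
      motive ((G.deleteIncidenceSet v).deleteIncidenceSet u)
        (isAcyclic_deleteIncidenceSet (isAcyclic_deleteIncidenceSet hG v) u) → motive G hG)
    {G : SimpleGraph V} (hG : G.IsAcyclic) : motive G hG := by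
  induction G using WellFoundedLT.induction with
  | _ G ih =>
    obtain rfl | hne := eq_or_ne G ⊥
    · exact bot
    obtain ⟨v, u, h⟩ := exists_neighborSet_eq_singleton_of_isAcyclic hG hne
    have hvu : G.Adj v u := h.ge rfl
    have hlt : G.deleteIncidenceSet v < G :=
      (G.deleteIncidenceSet_le v).lt_of_not_ge fun hle =>
        (SimpleGraph.deleteIncidenceSet_adj.1 (hle hvu)).2.1 rfl
    have hle := (G.deleteIncidenceSet v).deleteIncidenceSet_le u
    exact leaf G hG v u h (ih _ hlt _) (ih _ (hle.trans_lt hlt) _)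

theorem ncard_edgeSet_deleteIncidenceSet_add_one_of_leaf [Finite V] {G : SimpleGraph V} {u v : V}
    (h : G.neighborSet v = {u}) :
    (G.deleteIncidenceSet v).edgeSet.ncard + 1 = G.edgeSet.ncard := by
  classical
  have hinc : (G.incidenceSet v).ncard = 1 := by
    rw [← Nat.card_coe_set_eq, Nat.card_congr (G.incidenceSetEquivNeighborSet v), h,
      Nat.card_coe_set_eq, Set.ncard_singleton]
  rw [SimpleGraph.edgeSet_deleteIncidenceSet, ← hinc,
    Set.ncard_sdiff_add_ncard_of_subset (G.incidenceSet_subset v)]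

theorem ncard_support_deleteIncidenceSet_add_one_le [Finite V] {G : SimpleGraph V} {v : V}
    (hv : v ∈ G.support) :
    (G.deleteIncidenceSet v).support.ncard + 1 ≤ G.support.ncard := by
  rw [← Set.ncard_sdiff_singleton_add_one hv]
  gcongr
  · exact Set.toFinite _
  · exact G.support_deleteIncidenceSet_subset v

theorem ncard_support_deleteIncidenceSet_deleteIncidenceSet_add_two_le [Finite V]
    {G : SimpleGraph V} {u v : V} (h : G.Adj v u) :
    ((G.deleteIncidenceSet v).deleteIncidenceSet u).support.ncard + 2 ≤ G.support.ncard := by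
  have hv : v ∈ G.support := ⟨u, h⟩
  have hu : u ∈ G.support \ {v} := ⟨⟨v, h.symm⟩, h.ne'⟩
  rw [← Set.ncard_sdiff_singleton_add_one hv, ← Set.ncard_sdiff_singleton_add_one hu]
  refine Nat.succ_le_succ (Nat.succ_le_succ (Set.ncard_le_ncard ?_))
  exact ((G.deleteIncidenceSet v).support_deleteIncidenceSet_subset u).trans
    (Set.sdiff_subset_sdiff_left (G.support_deleteIncidenceSet_subset v))

end Forest

section Comparison

variable {V R : Type*} [Fintype V] [CommRing R] [PartialOrder R] [IsOrderedRing R] {a : R}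

theorem one_le_shiftDet (ha : a ^ 2 ≤ 0) {G : SimpleGraph V} (hG : G.IsAcyclic) :
    1 ≤ shiftDet a G := by
  induction hG using isAcyclic_induction with
  | bot => simp
  | leaf G _ v u h ihv ihu =>
    rw [shiftDet_eq_sub_of_leaf a h]
    exact ihv.trans ((le_sub_self_iff _).2
      (mul_nonpos_of_nonpos_of_nonneg ha (zero_le_one.trans ihu)))

theorem one_sub_mul_sq_le_shiftDet (ha : a ^ 2 ≤ 0) {G : SimpleGraph V} (hG : G.IsAcyclic) :
    1 - G.edgeSet.ncard * a ^ 2 ≤ shiftDet a G := by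
  induction hG using isAcyclic_induction with
  | bot => simp
  | leaf G hG v u h ihv _ =>
    have hG' := isAcyclic_deleteIncidenceSet (isAcyclic_deleteIncidenceSet hG v) u
    rw [shiftDet_eq_sub_of_leaf a h, ← ncard_edgeSet_deleteIncidenceSet_add_one_of_leaf h]
    push_cast
    linear_combination ihv + mul_le_mul_of_nonpos_left (one_le_shiftDet ha hG') ha

theorem shiftDet_starGraph_le_shiftDet (ha : a ^ 2 ≤ 0) {G : SimpleGraph V} (hG : G.IsAcyclic) :
    shiftDet a (SimpleGraph.starGraph (0 : Fin (G.edgeSet.ncard + 1))) ≤ shiftDet a G := by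
  rw [shiftDet_starGraph, Fintype.card_fin, Nat.cast_add_one, add_sub_cancel_right]
  exact one_sub_mul_sq_le_shiftDet ha hG

theorem one_le_shiftDet_pathGraph (ha : a ^ 2 ≤ 0) (n : ℕ) :
    1 ≤ shiftDet a (SimpleGraph.pathGraph n) := by
  induction n using Nat.twoStepInduction with
  | zero => simp
  | one => simp
  | more n ih ih' =>
    rw [shiftDet_pathGraph_add_two]
    linear_combination ih' + mul_nonpos_of_nonpos_of_nonneg ha (zero_le_one.trans ih)

theorem shiftDet_le_shiftDet_pathGraph (ha : a ^ 2 ≤ 0) {G : SimpleGraph V} (hG : G.IsAcyclic)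
    {n : ℕ} (hn : G.support.ncard ≤ n) : shiftDet a G ≤ shiftDet a (SimpleGraph.pathGraph n) := by
  induction hG using isAcyclic_induction generalizing n with
  | bot => simpa using one_le_shiftDet_pathGraph ha n
  | leaf G _ v u h ihv ihu =>
    have hvu : G.Adj v u := h.ge rfl
    have hv := ncard_support_deleteIncidenceSet_add_one_le (G := G) ⟨u, hvu⟩
    have hu := ncard_support_deleteIncidenceSet_deleteIncidenceSet_add_two_le hvu
    obtain ⟨k, rfl⟩ := Nat.exists_eq_add_of_le' (le_of_add_le_right (hu.trans hn))
    rw [shiftDet_eq_sub_of_leaf a h, shiftDet_pathGraph_add_two]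
    exact sub_le_sub (ihv (by lia)) (mul_le_mul_of_nonpos_left (ihu (by lia)) ha)

end Comparison

section Analysis

open MeasureTheory Set Filter Asymptotics
open scoped Topology

variable {p : ℝ}

theorem isBigO_log_one_add_sq_atTop {r : ℝ} (hr : 0 < r) :
    (fun t : ℝ => Real.log (1 + t ^ 2)) =O[atTop] fun t => t ^ r := by
  have hsq : Tendsto (fun t : ℝ => 1 + t ^ 2) atTop atTop :=
    tendsto_atTop_add_const_left _ _ (tendsto_pow_atTop two_ne_zero)
  have hlog := (isLittleO_log_rpow_atTop (half_pos hr)).isBigO.comp_tendsto hsq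
  refine hlog.trans (IsBigO.of_bound (2 ^ (r / 2)) ?_)
  filter_upwards [eventually_ge_atTop 1] with t ht
  have ht0 : 0 ≤ t := zero_le_one.trans ht
  rw [Function.comp_apply, Real.norm_of_nonneg (by positivity),
    Real.norm_of_nonneg (by positivity)]
  calc (1 + t ^ 2) ^ (r / 2) ≤ (2 * t ^ 2) ^ (r / 2) := by
        gcongr
        linarith [one_le_pow₀ (n := 2) ht]
    _ = 2 ^ (r / 2) * t ^ r := by
        rw [Real.mul_rpow zero_le_two (sq_nonneg t), ← Real.rpow_natCast_mul ht0, Nat.cast_ofNat,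
          mul_div_cancel₀ r two_ne_zero]

theorem isBigO_log_one_add_sq (l : Filter ℝ) :
    (fun t : ℝ => Real.log (1 + t ^ 2)) =O[l] fun t => t ^ 2 := by
  refine .of_norm_le fun t => ?_
  have ht : 0 < 1 + t ^ 2 := by positivity
  rw [Real.norm_of_nonneg (Real.log_nonneg (le_add_of_nonneg_right (sq_nonneg t)))]
  linarith [Real.log_le_sub_one_of_pos ht]

theorem integrableOn_rpow_mul_log_one_add_sq (hp0 : 0 < p) (hp2 : p < 2) :
    IntegrableOn (fun t : ℝ => t ^ (-p - 1) * Real.log (1 + t ^ 2)) (Ioi 0) := by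
  have hcont : Continuous fun t : ℝ => Real.log (1 + t ^ 2) :=
    Continuous.log (by fun_prop) fun t => by positivity
  refine mellin_convergent_of_isBigO_scalar (a := -(p / 2)) (b := -2)
    (hcont.locallyIntegrable.locallyIntegrableOn _) ?_ (by linarith) ?_ (by linarith)
  · simpa only [neg_neg] using isBigO_log_one_add_sq_atTop (half_pos hp0)
  · simpa only [neg_neg, Real.rpow_two] using isBigO_log_one_add_sq _

/-- The normalising constant `∫₀^∞ t ^ (-p - 1) log (1 + t ^ 2) dt` in the Coulson-type integral
formula for the `p`-Schatten energy. It is positive for `0 < p < 2`; outside this range the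
integral diverges and the definition returns `0`. -/
noncomputable def coulsonConst (p : ℝ) : ℝ :=
  ∫ t in Ioi (0 : ℝ), t ^ (-p - 1) * Real.log (1 + t ^ 2)

theorem coulsonConst_pos (hp0 : 0 < p) (hp2 : p < 2) : 0 < coulsonConst p := by
  have hpos : ∀ t ∈ Ioi (0 : ℝ), 0 < t ^ (-p - 1) * Real.log (1 + t ^ 2) := fun t ht =>
    mul_pos (Real.rpow_pos_of_pos ht _) (Real.log_pos (lt_add_of_pos_right 1 (sq_pos_of_pos ht)))
  have hsupp : Ioi 0 ⊆ Function.support fun t : ℝ => t ^ (-p - 1) * Real.log (1 + t ^ 2) :=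
    fun t ht => (hpos t ht).ne'
  rw [coulsonConst, setIntegral_pos_iff_support_of_nonneg_ae
    ((ae_restrict_mem measurableSet_Ioi).mono fun t ht => (hpos t ht).le)
    (integrableOn_rpow_mul_log_one_add_sq hp0 hp2),
    inter_eq_right.2 hsupp]
  simp

theorem rpow_mul_log_one_add_mul_sq {x t : ℝ} (hx : x ≠ 0) (ht : 0 < t) :
    t ^ (-p - 1) * Real.log (1 + (t * x) ^ 2) =
      |x| ^ (p + 1) * ((|x| * t) ^ (-p - 1) * Real.log (1 + (|x| * t) ^ 2)) := by
  have hx' : 0 < |x| := abs_pos.2 hx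
  have hcancel : |x| ^ (p + 1) * |x| ^ (-p - 1) = 1 := by
    rw [← Real.rpow_add hx', ← neg_add', add_neg_cancel, Real.rpow_zero]
  rw [Real.mul_rpow hx'.le ht.le, mul_pow |x|, sq_abs, mul_pow, mul_comm (x ^ 2), ← mul_assoc,
    ← mul_assoc, hcancel, one_mul]

theorem integrableOn_rpow_mul_log_one_add_mul_sq (hp0 : 0 < p) (hp2 : p < 2) (x : ℝ) :
    IntegrableOn (fun t : ℝ => t ^ (-p - 1) * Real.log (1 + (t * x) ^ 2)) (Ioi 0) := by
  obtain rfl | hx := eq_or_ne x 0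
  · simp
  have hscaled := (integrableOn_Ioi_comp_mul_left_iff
    (fun t : ℝ => t ^ (-p - 1) * Real.log (1 + t ^ 2)) 0 (abs_pos.2 hx)).2
    (by simpa only [mul_zero] using integrableOn_rpow_mul_log_one_add_sq hp0 hp2)
  exact IntegrableOn.congr_fun (hscaled.const_mul (|x| ^ (p + 1)))
    (fun t ht => (rpow_mul_log_one_add_mul_sq hx ht).symm) measurableSet_Ioi

theorem integral_rpow_mul_log_one_add_mul_sq (hp0 : 0 < p) (x : ℝ) :
    ∫ t in Ioi (0 : ℝ), t ^ (-p - 1) * Real.log (1 + (t * x) ^ 2) =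
      coulsonConst p * |x| ^ p := by
  obtain rfl | hx := eq_or_ne x 0
  · simp [Real.zero_rpow hp0.ne']
  have hx' : 0 < |x| := abs_pos.2 hx
  rw [setIntegral_congr_fun measurableSet_Ioi fun t ht => rpow_mul_log_one_add_mul_sq hx ht,
    integral_const_mul, integral_comp_mul_left_Ioi
      (fun t : ℝ => t ^ (-p - 1) * Real.log (1 + t ^ 2)) 0 hx', mul_zero, smul_eq_mul,
    Real.rpow_add_one hx'.ne', ← coulsonConst]
  field_simp

end Analysis

section Coulson

open MeasureTheory Set

variable {V W : Type*} [Fintype V] [Fintype W] {p : ℝ}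

open Classical in
theorem shiftDet_eq_prod_eigenvalues (a : ℂ) (G : SimpleGraph V) :
    shiftDet a G = ∏ i, (1 + a * (adjMatrix_isHermitian G).eigenvalues i) := by
  have hmap : G.adjMatrix ℂ = (G.adjMatrix ℝ).map Complex.ofRealHom := by
    ext i j
    simp [SimpleGraph.adjMatrix_apply, apply_ite]
  refine det_one_add_smul_of_charpoly_eq_prod ?_ a
  rw [hmap, Matrix.charpoly_map, (adjMatrix_isHermitian G).charpoly_eq, Polynomial.map_prod]
  simp

open Classical in
theorem norm_shiftDet_I_mul_sq (t : ℝ) (G : SimpleGraph V) :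
    ‖shiftDet (Complex.I * t) G‖ ^ 2 =
      ∏ i, (1 + (t * (adjMatrix_isHermitian G).eigenvalues i) ^ 2) := by
  rw [shiftDet_eq_prod_eigenvalues, norm_prod, ← Finset.prod_pow]
  refine Finset.prod_congr rfl fun i _ => ?_
  have hreim (x : ℝ) : 1 + Complex.I * t * x = (1 : ℝ) + (t * x : ℝ) * Complex.I := by
    push_cast
    ring
  rw [Complex.sq_norm, hreim, Complex.normSq_add_mul_I, one_pow]

theorem norm_shiftDet_I_mul_sq_pos (t : ℝ) (G : SimpleGraph V) :
    0 < ‖shiftDet (Complex.I * t) G‖ ^ 2 := by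
  rw [norm_shiftDet_I_mul_sq]
  exact Finset.prod_pos fun i _ => by positivity

open Classical in
theorem rpow_mul_log_norm_shiftDet_sq (t : ℝ) (G : SimpleGraph V) :
    t ^ (-p - 1) * Real.log (‖shiftDet (Complex.I * t) G‖ ^ 2) =
      ∑ i, t ^ (-p - 1) * Real.log (1 + (t * (adjMatrix_isHermitian G).eigenvalues i) ^ 2) := by
  rw [norm_shiftDet_I_mul_sq, Real.log_prod fun i _ => by positivity, Finset.mul_sum]

theorem integrableOn_rpow_mul_log_norm_shiftDet_sq (hp0 : 0 < p) (hp2 : p < 2)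
    (G : SimpleGraph V) :
    IntegrableOn (fun t : ℝ => t ^ (-p - 1) * Real.log (‖shiftDet (Complex.I * t) G‖ ^ 2))
      (Ioi 0) := by
  simp_rw [rpow_mul_log_norm_shiftDet_sq]
  exact integrable_finsetSum _ fun i _ => integrableOn_rpow_mul_log_one_add_mul_sq hp0 hp2 _

theorem integral_rpow_mul_log_norm_shiftDet_sq (hp0 : 0 < p) (hp2 : p < 2)
    (G : SimpleGraph V) :
    ∫ t in Ioi (0 : ℝ), t ^ (-p - 1) * Real.log (‖shiftDet (Complex.I * t) G‖ ^ 2) =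
      coulsonConst p * energy p G := by
  simp_rw [rpow_mul_log_norm_shiftDet_sq]
  rw [integral_finsetSum _ fun i _ => integrableOn_rpow_mul_log_one_add_mul_sq hp0 hp2 _, energy,
    Finset.mul_sum]
  exact Finset.sum_congr rfl fun i _ => integral_rpow_mul_log_one_add_mul_sq hp0 _

open scoped ComplexOrder in
theorem energy_le_energy (hp0 : 0 < p) (hp2 : p < 2) {G : SimpleGraph V} {H : SimpleGraph W}
    (h : ∀ a : ℂ, a ^ 2 ≤ 0 → ‖shiftDet a G‖ ≤ ‖shiftDet a H‖) :
    energy p G ≤ energy p H := by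
  refine le_of_mul_le_mul_left ?_ (coulsonConst_pos hp0 hp2)
  rw [← integral_rpow_mul_log_norm_shiftDet_sq hp0 hp2,
    ← integral_rpow_mul_log_norm_shiftDet_sq hp0 hp2]
  refine setIntegral_mono_on (integrableOn_rpow_mul_log_norm_shiftDet_sq hp0 hp2 G)
    (integrableOn_rpow_mul_log_norm_shiftDet_sq hp0 hp2 H) measurableSet_Ioi fun t ht => ?_
  have hnorm := h (Complex.I * t) (by simp [Complex.sq_nonpos_iff])
  have hpos := norm_shiftDet_I_mul_sq_pos t G
  have ht' := Real.rpow_nonneg (le_of_lt ht) (-p - 1)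
  gcongr

end Coulson

end SchattenEnergy

open SchattenEnergy ComplexOrder in
theorem theorem2_general {V : Type*} [Fintype V] (G : SimpleGraph V) (hG : G.IsAcyclic) (p : ℝ)
    (hp0 : 0 < p) (hp2 : p < 2) :
    energy p (SimpleGraph.starGraph (0 : Fin (G.edgeSet.ncard + 1))) ≤ energy p G ∧
      energy p G ≤ energy p (SimpleGraph.pathGraph (Fintype.card V)) := by
  have hstar := (SimpleGraph.isTree_starGraph (0 : Fin (G.edgeSet.ncard + 1))).isAcyclic
  refine ⟨energy_le_energy hp0 hp2 fun a ha => ?_, energy_le_energy hp0 hp2 fun a ha => ?_⟩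
  · exact CStarAlgebra.norm_le_norm_of_nonneg_of_le (zero_le_one.trans (one_le_shiftDet ha hstar))
      (shiftDet_starGraph_le_shiftDet ha hG)
  · exact CStarAlgebra.norm_le_norm_of_nonneg_of_le (zero_le_one.trans (one_le_shiftDet ha hG))
      (shiftDet_le_shiftDet_pathGraph ha hG
        ((Set.ncard_le_card _).trans_eq Nat.card_eq_fintype_card))

theorem theorem2 {V : Type*} [Fintype V] (T : SimpleGraph V) (hT : T.IsTree)
    (n : ℕ) [NeZero n] (hn : Fintype.card V = n) (p : ℝ) (hp0 : 0 < p) (hp2 : p < 2) :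
    SchattenEnergy.energy p (SimpleGraph.starGraph (0 : Fin n)) ≤ SchattenEnergy.energy p T ∧
      SchattenEnergy.energy p T ≤ SchattenEnergy.energy p (SimpleGraph.pathGraph n) := by
  obtain rfl : T.edgeSet.ncard + 1 = n :=
    (SimpleGraph.isTree_iff_connected_and_card.1 hT).2.trans (Nat.card_eq_fintype_card.trans hn)
  have h := theorem2_general T hT.isAcyclic p hp0 hp2
  rwa [hn] at h
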